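/- Let $m,q\ge 0$, $X=\{x_0,\dots,x_m\}$ and $X'=\{x'_0,\dots,x'_q\}$. For an alphabet $Z=\{z_0,\dots,z_n\}$ let $\mathbb R^{\ell}\langle\langle Z\rangle\rangle$ be the set of all formal power series $c=\sum_{\eta\in Z^*}(c,\eta)\,\eta$ with coefficients in $\mathbb R^\ell$; $c$ is purely improper if every component of $(c,\emptyset)$ is nonzero. Products of vectors are componentwise, $⧢$ is the (componentwise) shuffle product, $\mathbf 1$ is the monomial $1\emptyset$, and $1\!\mathrm l=(\mathbf 1,\dots,\mathbf 1)$. For purely improper $d$, $d^{⧢-1}$ denotes the shuffle inverse, $(d^{⧢-1})_i=(d_i,\emptyset)^{-1}\sum_{k\ge 0}\bigl(\mathbf 1-d_i/(d_i,\emptyset)\bigr)^{⧢ k}$. Composition products. For $a\in\mathbb R^k\langle\langle X'\rangle\rangle$ and $b\in\mathbb R^q\langle\langle X\rangle\rangle$ let $a\circ b=\sum_{\eta\in X'^*}(a,\eta)\,\psi_b(\eta)(\mathbf 1)$, where $\psi_b$ is multiplicative on words with $\psi_b(x'_i)(e)=x_0(b_i ⧢ e)$, $b_0=\mathbf 1$.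 For $a\in\mathbb R^p\langle\langle X\rangle\rangle$ and $g\in\mathbb R^m\langle\langle X\rangle\rangle$ let $a\,\tilde\circ\,\delta_g=\sum_{\eta\in X^*}(a,\eta)\,\bar\phi_g(\eta)(\mathbf 1)$, where $\bar\phi_g$ is multiplicative on words with $\bar\phi_g(x_0)(e)=x_0e$ and $\bar\phi_g(x_i)(e)=x_i(g_i ⧢ e)$ for $i\ge1$; here $\delta_g=\delta ⧢ g$ is a formal symbol. On these symbols put $\delta_f\circ\delta_g=\delta_{g ⧢ (f\tilde\circ\delta_g)}$, with identity element $\delta_{1\!\mathrm l}$; $f^{\circ-1}$ denotes the purely improper series for which $\delta_{f^{\circ-1}}$ is the two-sided inverse of $\delta_f$. Formal Chen–Fliess operators. Signals are formal power series in $t-t_0$ with real coefficients. For $c\in\mathbb R^\ell\langle\langle Z\rangle\rangle$, $Z=\{z_0,\dots,z_n\}$, and an input $u=(u_1,\dots,u_n)$ put $F_c[u]=\sum_{\eta\in Z^*}(c,\eta)E_\eta[u]$, where $E_\emptyset[u]=1$, $E_{z_i\eta}[u]=\int_{t_0}^t u_i(\tau)E_\eta[u](\tau)\,d\tau$ (formal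 antiderivative without constant term) and $u_0=1$. (All the sums above are finite in each coefficient.) Theorem. Let $c\in\mathbb R^q\langle\langle X\rangle\rangle$ and let $d\in\mathbb R^m\langle\langle X'\rangle\rangle$ be purely improper. Then $d^{⧢-1}\circ c$ is purely improper, $(d^{⧢-1}\circ c)^{\circ-1}$ exists and is unique, and the multiplicative dynamic feedback product $$c\,\check{@}\,d:=c\,\tilde\circ\,\delta_{(d^{⧢-1}\circ c)^{\circ-1}}\in\mathbb R^q\langle\langle X\rangle\rangle$$ is the unique generating series of the closed-loop system in which $F_c$ is in multiplicative output feedback with $F_d$. That is, $e=c\,\check{@}\,d$ is the one and only series $e\in\mathbb R^q\langle\langle X\rangle\rangle$ such that for every external input $v$ (an $m$-tuple of formal signals) the closed-loop equations $$y=F_c[u],\qquad u=v\cdot F_d[y]$$ are solvable, and $y=F_e[v]$ is their only output. Moreover, $e=c\,\check{@}\,d$ is the unique solution $e\in\mathbb R^q\langle\langle X\rangle\rangle$ of the closed-loop equation between series $e=c\,\tilde\circ\,\delta_{(d\circ e)}$. -/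

import Mathlib

open scoped PowerSeries

noncomputable section

namespace ChenFliess

/-! ### Words and formal power series

The alphabet `{x₀, x₁, …, xₘ}` is `Fin (m + 1)`, a word is a list of letters, the empty word is `[]`.
-/

/-- Words over the alphabet `{x₀, …, xₘ}`. -/
abbrev Word (m : ℕ) : Type := List (Fin (m + 1))

/-- Scalar formal power series in the noncommuting letters `x₀, …, xₘ`. -/
abbrev ScalarSeries (m : ℕ) : Type := Word m → ℝ

/-- Formal power series in the noncommuting letters `x₀, …, xₘ`, with coefficients in `ℝ^ℓ`. -/
abbrev Series (m ℓ : ℕ) : Type := Word m → Fin ℓ → ℝ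

/-- The `i`-th component series. -/
def component {m ℓ : ℕ} (c : Series m ℓ) (i : Fin ℓ) : ScalarSeries m := fun η => c η i

/-- The monomial `1 ∅`. -/
def oneScalar (m : ℕ) : ScalarSeries m := fun η => if η = [] then 1 else 0

/-- The constant series with coefficient vector `(1, …, 1)`. -/
def one (m ℓ : ℕ) : Series m ℓ := fun η _ => oneScalar m η

/-- Every component has a nonzero constant term. -/
def PurelyImproper {m ℓ : ℕ} (c : Series m ℓ) : Prop := ∀ i, c [] i ≠ 0

/-- Left multiplication `e ↦ x e` by a letter `x`. -/
def letterMul {m : ℕ} (x : Fin (m + 1)) (e : ScalarSeries m) : ScalarSeries m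
  | [] => 0
  | y :: η => if y = x then e η else 0

/-! ### Shuffle product -/

/-- The shuffle product of two words: the multiset of words which occur in it. -/
def shuffleWords {α : Type*} : List α → List α → Multiset (List α)
  | [], ν => {ν}
  | x :: ζ, [] => {x :: ζ}
  | x :: ζ, y :: ν =>
      (shuffleWords ζ (y :: ν)).map (List.cons x) + (shuffleWords (x :: ζ) ν).map (List.cons y)
  termination_by ζ ν => ζ.length + ν.length

theorem length_of_mem_shuffleWords {α : Type*} (ζ ν η : List α) (h : η ∈ shuffleWords ζ ν) :
    η.length = ζ.length + ν.length := by
  induction ζ, ν using shuffleWords.induct generalizing η with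
  | case1 ν => simp_all [shuffleWords]
  | case2 x ζ => simp_all [shuffleWords]
  | case3 x ζ y ν ih1 ih2 =>
    rw [shuffleWords, Multiset.mem_add, Multiset.mem_map, Multiset.mem_map] at h
    rcases h with ⟨w, hw, rfl⟩ | ⟨w, hw, rfl⟩
    · have := ih1 w hw
      simp only [List.length_cons] at this ⊢
      omega
    · have := ih2 w hw
      simp only [List.length_cons] at this ⊢
      omega

/-- The shuffle product of scalar series: the coefficient of `η` is the sum over all pairs of words
`(ζ, ν)` of `(c, ζ) (d, ν) (ζ ⧢ ν, η)`. -/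
def shuffleScalar {m : ℕ} (c d : ScalarSeries m) : ScalarSeries m := fun η =>
  ∑ᶠ p : Word m × Word m, c p.1 * d p.2 * ((shuffleWords p.1 p.2).count η : ℝ)

theorem finite_words (m n : ℕ) : {η : Word m | η.length ≤ n}.Finite :=
  List.finite_length_le _ n

/-- The sum which defines the shuffle product has finite support. -/
theorem finite_support_shuffleScalar {m : ℕ} (c d : ScalarSeries m) (η : Word m) :
    (Function.support fun p : Word m × Word m =>
      c p.1 * d p.2 * ((shuffleWords p.1 p.2).count η : ℝ)).Finite := by
  refine ((finite_words m η.length).prod (finite_words m η.length)).subset ?_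
  intro p hp
  have h : (shuffleWords p.1 p.2).count η ≠ 0 := by
    intro h0
    simp [h0] at hp
  have := length_of_mem_shuffleWords _ _ _ (Multiset.count_ne_zero.mp h)
  simp only [Set.mem_prod, Set.mem_ofPred_eq]
  omega

/-- The `k`-th shuffle power. -/
def shufflePow {m : ℕ} (c : ScalarSeries m) : ℕ → ScalarSeries m
  | 0 => oneScalar m
  | k + 1 => shuffleScalar c (shufflePow c k)

/-- The shuffle product of vector-valued series, taken componentwise. -/
def shuffle {m ℓ : ℕ} (c d : Series m ℓ) : Series m ℓ := fun η i =>
  shuffleScalar (component c i) (component d i) η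

/-- The series `1 - d / (d, ∅)`. -/
def normalizedPart {m : ℕ} (d : ScalarSeries m) : ScalarSeries m := fun η =>
  oneScalar m η - d η / d []

/-- The shuffle inverse `(d, ∅)⁻¹ ∑ₖ (1 - d / (d, ∅))^{⧢ k}` of each component. -/
def shuffleInv {m ℓ : ℕ} (d : Series m ℓ) : Series m ℓ := fun η i =>
  (d [] i)⁻¹ * ∑ᶠ k : ℕ, shufflePow (normalizedPart (component d i)) k η

theorem shuffleScalar_eq_zero {m : ℕ} (c d : ScalarSeries m) (a b : ℕ)
    (hc : ∀ η : Word m, η.length < a → c η = 0) (hd : ∀ η : Word m, η.length < b → d η = 0)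
    (η : Word m) (hη : η.length < a + b) : shuffleScalar c d η = 0 := by
  refine finsum_eq_zero_of_forall_eq_zero fun p => ?_
  by_cases h : (shuffleWords p.1 p.2).count η = 0
  · simp [h]
  · have := length_of_mem_shuffleWords _ _ _ (Multiset.count_ne_zero.mp h)
    rcases lt_or_ge p.1.length a with h1 | h1
    · simp [hc _ h1]
    · have h2 : p.2.length < b := by omega
      simp [hd _ h2]

theorem shufflePow_eq_zero {m : ℕ} (c : ScalarSeries m) (hc : c [] = 0) (k : ℕ) (η : Word m)
    (hη : η.length < k) : shufflePow c k η = 0 := by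
  induction k generalizing η with
  | zero => omega
  | succ k ih =>
    refine shuffleScalar_eq_zero c _ 1 k ?_ ih η (by omega)
    intro w hw
    have : w = [] := List.length_eq_zero_iff.mp (by omega)
    rw [this, hc]

/-- The sum which defines the shuffle inverse of a purely improper series has finite support. -/
theorem finite_support_shuffleInv {m ℓ : ℕ} (d : Series m ℓ) (hd : PurelyImproper d) (η : Word m)
    (i : Fin ℓ) :
    (Function.support fun k : ℕ => shufflePow (normalizedPart (component d i)) k η).Finite := by
  refine (Set.finite_le_nat η.length).subset ?_
  intro k hk
  by_contra h
  refine hk (shufflePow_eq_zero _ ?_ k η (by simpa using h))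
  simp [normalizedPart, oneScalar, component, hd i]

/-! ### Composition product -/

/-- `ψ_d(η)` for a word `η` in `x'₀, …, x'_ℓ`: the algebra homomorphism determined by
`ψ_d(x'ᵢ)(e) = x₀ (dᵢ ⧢ e)`, with `d₀ = 1`. -/
def psi {m ℓ : ℕ} (d : Series m ℓ) : Word ℓ → ScalarSeries m → ScalarSeries m
  | [], e => e
  | i :: η, e =>
      letterMul 0 (shuffleScalar
        ((Fin.cons (oneScalar m) (component d) : Fin (ℓ + 1) → ScalarSeries m) i) (psi d η e))

/-- The composition product `c ∘ d = ∑_η (c, η) ψ_d(η)(1)`. -/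
def comp {m ℓ k : ℕ} (c : Series ℓ k) (d : Series m ℓ) : Series m k := fun ξ j =>
  ∑ᶠ η : Word ℓ, c η j * psi d η (oneScalar m) ξ

theorem letterMul_eq_zero {m : ℕ} (x : Fin (m + 1)) (e : ScalarSeries m) (n : ℕ)
    (he : ∀ η : Word m, η.length < n → e η = 0) (η : Word m) (hη : η.length < n + 1) :
    letterMul x e η = 0 := by
  cases η with
  | nil => rfl
  | cons y η =>
    have : η.length < n := by simpa using hη
    simp [letterMul, he _ this]

theorem psi_eq_zero {m ℓ : ℕ} (d : Series m ℓ) (η : Word ℓ) (e : ScalarSeries m) (ξ : Word m)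
    (h : ξ.length < η.length) : psi d η e ξ = 0 := by
  induction η generalizing ξ with
  | nil => simp at h
  | cons i η ih =>
    refine letterMul_eq_zero _ _ η.length ?_ ξ (by simpa using h)
    intro w hw
    exact shuffleScalar_eq_zero _ _ 0 η.length (by simp) ih w (by simpa using hw)

/-- The sum which defines the composition product has finite support. -/
theorem finite_support_comp {m ℓ k : ℕ} (c : Series ℓ k) (d : Series m ℓ) (ξ : Word m)
    (j : Fin k) : (Function.support fun η : Word ℓ => c η j * psi d η (oneScalar m) ξ).Finite := by
  refine (finite_words ℓ ξ.length).subset ?_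
  intro η hη
  by_contra h
  exact hη (by simp [psi_eq_zero d η (oneScalar m) ξ (by simpa using h)])

/-! ### Multiplicative mixed composition product

The series `δ ⧢ d`, the generating series of `u ↦ u · F_d[u]`, is represented by `d` itself.
-/

/-- `φ_d(η)` for a word `η`: the algebra homomorphism determined by `φ_d(x₀)(e) = x₀ e` and
`φ_d(xᵢ)(e) = xᵢ (dᵢ ⧢ e)` for `i ≥ 1`. -/
def phi {m : ℕ} (d : Series m m) : Word m → ScalarSeries m → ScalarSeries m
  | [], e => e
  | x :: η, e =>
      Fin.cases (letterMul 0 (phi d η e))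
        (fun i => letterMul i.succ (shuffleScalar (component d i) (phi d η e))) x

/-- The multiplicative mixed composition product of `c` and `δ ⧢ d`: the sum
`∑_η (c, η) φ_d(η)(1)`. -/
def mixComp {m p : ℕ} (c : Series m p) (d : Series m m) : Series m p := fun ξ j =>
  ∑ᶠ η : Word m, c η j * phi d η (oneScalar m) ξ

theorem phi_eq_zero {m : ℕ} (d : Series m m) (η : Word m) (e : ScalarSeries m) (ξ : Word m)
    (h : ξ.length < η.length) : phi d η e ξ = 0 := by
  induction η generalizing ξ with
  | nil => simp at h
  | cons x η ih =>
    have h' : ξ.length < η.length + 1 := by simpa using h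
    refine Fin.cases ?_ (fun i => ?_) x
    · exact letterMul_eq_zero _ _ η.length ih ξ h'
    · refine letterMul_eq_zero _ _ η.length ?_ ξ h'
      intro w hw
      exact shuffleScalar_eq_zero _ _ 0 η.length (by simp) ih w (by simpa using hw)

/-- The sum which defines the multiplicative mixed composition product has finite support. -/
theorem finite_support_mixComp {m p : ℕ} (c : Series m p) (d : Series m m) (ξ : Word m)
    (j : Fin p) : (Function.support fun η : Word m => c η j * phi d η (oneScalar m) ξ).Finite := by
  refine (finite_words m ξ.length).subset ?_
  intro η hη
  by_contra h
  exact hη (by simp [phi_eq_zero d η (oneScalar m) ξ (by simpa using h)])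

/-- The multiplicative composition product: `(δ ⧢ c) ∘ (δ ⧢ d) = δ ⧢ (d ⧢ (c mixed with δ ⧢ d))`. -/
def mulComp {m : ℕ} (c d : Series m m) : Series m m := shuffle d (mixComp c d)

/-- `δ ⧢ g` is an inverse of `δ ⧢ f`, among the series `δ ⧢ d` with `d` purely improper, for the
multiplicative composition product, whose identity element is `δ ⧢ 1`. -/
def IsMulCompInv {m : ℕ} (f g : Series m m) : Prop :=
  PurelyImproper g ∧ mulComp f g = one m m ∧ mulComp g f = one m m

open Classical in
/-- The series `f^{∘ -1}`, that is, the `g` for which `δ ⧢ g` is the inverse of `δ ⧢ f` (and the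
zero series if `δ ⧢ f` is not invertible). -/
def mulCompInv {m : ℕ} (f : Series m m) : Series m m :=
  if h : ∃ g, IsMulCompInv f g then h.choose else 0

/-- The multiplicative dynamic feedback product: the multiplicative mixed composition product of
`c` and `δ ⧢ (d^{⧢ -1} ∘ c)^{∘ -1}`. -/
def feedbackProduct {m q : ℕ} (c : Series m q) (d : Series q m) : Series m q :=
  mixComp c (mulCompInv (comp (shuffleInv d) c))

/-! ### Chen-Fliess series as formal operators

Signals are formal power series in the time variable `t - t₀`.
-/

/-- The formal antiderivative `∫_{t₀}^t f(τ) dτ`. -/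
def formalIntegral (f : ℝ⟦X⟧) : ℝ⟦X⟧ :=
  PowerSeries.mk fun n => Nat.casesOn n 0 fun k => PowerSeries.coeff k f / ((k : ℝ) + 1)

/-- The iterated integral `E_η[u]`: `E_∅[u] = 1` and `E_{xᵢ η}[u] = ∫ uᵢ E_η[u]`, with `u₀ = 1`. -/
def iterIntegral {m : ℕ} (u : Fin m → ℝ⟦X⟧) : Word m → ℝ⟦X⟧
  | [] => 1
  | i :: η => formalIntegral ((Fin.cons 1 u : Fin (m + 1) → ℝ⟦X⟧) i * iterIntegral u η)

/-- The formal Chen-Fliess operator `F_c[u] = ∑_η (c, η) E_η[u]`. -/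
def fliess {m ℓ : ℕ} (c : Series m ℓ) (u : Fin m → ℝ⟦X⟧) : Fin ℓ → ℝ⟦X⟧ := fun j =>
  PowerSeries.mk fun n => ∑ᶠ η : Word m, c η j * PowerSeries.coeff n (iterIntegral u η)

theorem coeff_formalIntegral_eq_zero (f : ℝ⟦X⟧) (a : ℕ)
    (hf : ∀ n < a, PowerSeries.coeff n f = 0) (n : ℕ) (hn : n < a + 1) :
    PowerSeries.coeff n (formalIntegral f) = 0 := by
  cases n with
  | zero => simp [formalIntegral]
  | succ k => simp [formalIntegral, hf k (by omega)]

theorem coeff_iterIntegral_eq_zero {m : ℕ} (u : Fin m → ℝ⟦X⟧) (η : Word m) (n : ℕ)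
    (h : n < η.length) : PowerSeries.coeff n (iterIntegral u η) = 0 := by
  induction η generalizing n with
  | nil => simp at h
  | cons i η ih =>
    refine coeff_formalIntegral_eq_zero _ η.length ?_ n (by simpa using h)
    intro k hk
    rw [PowerSeries.coeff_mul]
    refine Finset.sum_eq_zero fun p hp => ?_
    have := Finset.HasAntidiagonal.mem_antidiagonal.mp hp
    rw [ih p.2 (by omega), mul_zero]

/-- Each coefficient of `F_c[u]` is a sum with finite support, for every `c` and every `u`. -/
theorem finite_support_fliess {m ℓ : ℕ} (c : Series m ℓ) (u : Fin m → ℝ⟦X⟧) (j : Fin ℓ) (n : ℕ) :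
    (Function.support fun η : Word m =>
      c η j * PowerSeries.coeff n (iterIntegral u η)).Finite := by
  refine (finite_words m n).subset ?_
  intro η hη
  by_contra h
  exact hη (by simp [coeff_iterIntegral_eq_zero u η n (by simpa using h)])

/-! ### Multiplicative output feedback -/

/-- The equations of the multiplicative output feedback loop with external input `v`, plant input
`u` and output `y`: the plant gives `y = F_c[u]`, and `u = v · F_d[y]` componentwise. -/
def IsClosedLoop {m q : ℕ} (c : Series m q) (d : Series q m) (v u : Fin m → ℝ⟦X⟧)
    (y : Fin q → ℝ⟦X⟧) : Prop :=
  y = fliess c u ∧ u = v * fliess d y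

/-- `e` is a generating series of the closed-loop system: for every external input `v`, the loop
is solvable, and `F_e[v]` is its only output. -/
def IsClosedLoopSeries {m q : ℕ} (c : Series m q) (d : Series q m) (e : Series m q) : Prop :=
  ∀ (v : Fin m → ℝ⟦X⟧) (y : Fin q → ℝ⟦X⟧), (∃ u, IsClosedLoop c d v u y) ↔ y = fliess e v

end ChenFliess

end

/-!
All identities between series are proved through the operators which they generate.

For a fixed input `u` the map `c ↦ F_c[u]` is linear, and `F_c[u]` is determined by its constant
term `(c, ∅)` and the state equation `F_c[u]' = ∑ⱼ uⱼ F_{xⱼ⁻¹ c}[u]` (`derivative_fliessScalar`).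
This gives `F_{c ⧢ d} = F_c · F_d`, `F_{c ∘ d} = F_c ∘ F_d` and
`F_{c ∘~ δ_g}[u] = F_c[u · F_g[u]]` (`fliess_shuffle`, `fliess_comp`, `fliess_mixComp`).

Conversely, a series is determined by its operator on formal inputs (`fliess_injective`). Perturb
the input `uᵢ` by `tⁿ`: the coefficient of `t^{n + k}` in the derivative of the response of `F_c`
tends, as `n → ∞`, to the coefficient of `t^k` in `F_{xᵢ⁻¹ c}[u]`, so if `F_c` vanishes, then so do
the operators of all left shifts of `c`, and the constant terms of the iterated shifts are the
coefficients of `c`.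

By injectivity the product of the symbols `δ_f`, which corresponds to the composition of the maps
`u ↦ u · F_f[u]`, is associative with identity `δ_1`. A right inverse of `δ_f` is a solution of
`g = f^{⧢ -1} ∘~ δ_g`, which exists because the right-hand side is a contraction in `g`; as every
purely improper series has a right inverse, inverses are two-sided (`existsUnique_isMulCompInv`).

With `f = d^{⧢ -1} ∘ c`, the loop equation `u = v · F_d[F_c[u]]` reads `u · F_f[u] = v`, and its only
solution is `u = v · F_g[v]` where `g = f^{∘ -1}`. Hence the only output is
`F_c[v · F_g[v]] = F_{c ∘~ δ_g}[v]` (`exists_isClosedLoop_iff`). The equation `e = c ∘~ δ_{d ∘ e}`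
says, in terms of operators, that `F_e[v]` is an output of the loop for every `v`.
-/

namespace ChenFliess

open PowerSeries Finset

/-! ### Finite sums over words of bounded length -/

/-- The finite set of words of length at most `n`. -/
noncomputable def words (m n : ℕ) : Finset (Word m) := (finite_words m n).toFinset

@[simp]
theorem mem_words {m n : ℕ} {η : Word m} : η ∈ words m n ↔ η.length ≤ n := by
  simp [words]

theorem sum_words_succ {m : ℕ} {M : Type*} [AddCommMonoid M] (n : ℕ) (f : Word m → M) :
    ∑ η ∈ words m (n + 1), f η = f [] + ∑ j : Fin (m + 1), ∑ η ∈ words m n, f (j :: η) := by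
  classical
  have h : words m (n + 1) = insert [] ((univ ×ˢ words m n).image
      fun p : Fin (m + 1) × Word m => p.1 :: p.2) := by
    ext η
    cases η <;> simp
  rw [h, sum_insert (by simp), sum_image (by rintro ⟨a, b⟩ _ ⟨a', b'⟩ _ h; simpa using h),
    sum_product]

theorem finsum_eq_sum_words {m : ℕ} {f : Word m → ℝ} {n : ℕ}
    (h : ∀ η : Word m, n < η.length → f η = 0) : ∑ᶠ η, f η = ∑ η ∈ words m n, f η := by
  refine finsum_eq_sum_of_support_subset _ fun η hη => ?_
  by_contra h'
  exact hη (h η (by simpa using h'))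

theorem shuffleScalar_eq_sum {m : ℕ} (c d : ScalarSeries m) (η : Word m) {N N' : ℕ}
    (hN : η.length ≤ N) (hN' : η.length ≤ N') :
    shuffleScalar c d η = ∑ p ∈ words m N, ∑ q ∈ words m N',
      c p * d q * ((shuffleWords p q).count η : ℝ) := by
  rw [shuffleScalar, ← sum_product' (f := fun p q : Word m =>
    c p * d q * ((shuffleWords p q).count η : ℝ))]
  refine finsum_eq_sum_of_support_subset _ fun p hp => ?_
  have h : (shuffleWords p.1 p.2).count η ≠ 0 := by
    intro h0
    simp [h0] at hp
  have := length_of_mem_shuffleWords _ _ _ (Multiset.count_ne_zero.mp h)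
  simp only [coe_product, Set.mem_prod, mem_coe, mem_words]
  omega

/-! ### Left shifts -/

/-- The left shift `x⁻¹ c` of a series by a letter: `(x⁻¹ c, η) = (c, x η)`. -/
def shift {m : ℕ} (x : Fin (m + 1)) (c : ScalarSeries m) : ScalarSeries m := fun η => c (x :: η)

theorem count_cons_shuffleWords {m : ℕ} (x : Fin (m + 1)) (η p q : Word m) :
    (shuffleWords p q).count (x :: η) =
      (if p.head? = some x then (shuffleWords p.tail q).count η else 0) +
      (if q.head? = some x then (shuffleWords p q.tail).count η else 0) := by
  have hc : ∀ (y : Fin (m + 1)) (s : Multiset (Word m)),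
      (s.map (List.cons y)).count (x :: η) = if y = x then s.count η else 0 := by
    intro y s
    split_ifs with h
    · subst h
      exact Multiset.count_map_eq_count' _ _ (List.cons_injective) _
    · refine Multiset.count_eq_zero_of_notMem fun h' => ?_
      obtain ⟨w, -, hw⟩ := Multiset.mem_map.mp h'
      exact h (List.cons.inj hw).1
  rcases p with _ | ⟨y, p⟩ <;> rcases q with _ | ⟨z, q⟩
  · simp [shuffleWords]
  · have := hc z {q}
    simp only [Multiset.map_singleton] at this
    simp [shuffleWords, this]
  · have := hc y {p}
    simp only [Multiset.map_singleton] at this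
    cases p <;> simp_all [shuffleWords]
  · simp [shuffleWords, hc]

/-- Left shifts are derivations of the shuffle product. -/
theorem shift_shuffleScalar {m : ℕ} (x : Fin (m + 1)) (c d : ScalarSeries m) :
    shift x (shuffleScalar c d) = shuffleScalar (shift x c) d + shuffleScalar c (shift x d) := by
  funext η
  have h1 : shuffleScalar c d (x :: η) = _ :=
    shuffleScalar_eq_sum c d (x :: η) (N := η.length + 1) (N' := η.length + 1) (by simp) (by simp)
  have h2 := shuffleScalar_eq_sum (shift x c) d η (N := η.length) (N' := η.length + 1)
    le_rfl (by simp)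
  have h3 := shuffleScalar_eq_sum c (shift x d) η (N := η.length + 1) (N' := η.length)
    (by simp) le_rfl
  rw [Pi.add_apply, h2, h3, shift, h1]
  simp only [count_cons_shuffleWords, Nat.cast_add, mul_add, sum_add_distrib]
  congr 1
  · rw [sum_words_succ, Finset.sum_eq_single x]
    · simp [shift]
    · intro j _ hj
      simp [hj]
    · simp
  · refine sum_congr rfl fun p _ => ?_
    rw [sum_words_succ, Finset.sum_eq_single x]
    · simp [shift]
    · intro j _ hj
      simp [hj]
    · simp

theorem shuffleScalar_nil {m : ℕ} (c d : ScalarSeries m) :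
    shuffleScalar c d [] = c [] * d [] := by
  have h : words m 0 = {[]} := by
    ext η
    simp
  rw [shuffleScalar_eq_sum c d [] (N := 0) (N' := 0) (by simp) (by simp)]
  simp [h, shuffleWords]

/-! ### Formal power series determined by differential relations -/

theorem coeff_eq_of_derivative (f : ℝ⟦X⟧) (n : ℕ) :
    coeff (n + 1) f = coeff n (derivative ℝ f) / ((n : ℝ) + 1) := by
  rw [coeff_derivative, mul_div_assoc, div_self (by positivity), mul_one]

theorem X_pow_succ_dvd_of_derivative {f : ℝ⟦X⟧} {n : ℕ} (h0 : constantCoeff f = 0)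
    (h : (X : ℝ⟦X⟧) ^ n ∣ derivative ℝ f) : (X : ℝ⟦X⟧) ^ (n + 1) ∣ f := by
  rw [X_pow_dvd_iff] at h ⊢
  rintro (_ | k) hk
  · simpa using h0
  · rw [coeff_eq_of_derivative, h k (by omega), zero_div]

/-- A set of power series without constant terms whose derivatives lie in the ideal which it
generates contains only zero: such a set satisfies a homogeneous linear differential system. -/
theorem eq_zero_of_derivative_mem_span (S : Set ℝ⟦X⟧) (h0 : ∀ f ∈ S, constantCoeff f = 0)
    (hS : ∀ f ∈ S, derivative ℝ f ∈ Ideal.span S) (f : ℝ⟦X⟧) (hf : f ∈ S) : f = 0 := by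
  have key : ∀ n : ℕ, ∀ f ∈ S, (X : ℝ⟦X⟧) ^ n ∣ f := by
    intro n
    induction n with
    | zero => simp
    | succ n ih =>
      intro f hf
      refine X_pow_succ_dvd_of_derivative (h0 f hf) ?_
      have hle : Ideal.span S ≤ Ideal.span {(X : ℝ⟦X⟧) ^ n} :=
        Ideal.span_le.mpr fun g hg => Ideal.mem_span_singleton.mpr (ih g hg)
      exact Ideal.mem_span_singleton.mp (hle (hS f hf))
  ext n
  simpa using X_pow_dvd_iff.mp (key (n + 1) f hf) n (by omega)

/-! ### Scalar Chen-Fliess operators -/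

/-- The inputs `(1, u₁, …, uₘ)`, with the drift input `u₀ = 1` included. -/
noncomputable def withDrift {m : ℕ} (u : Fin m → ℝ⟦X⟧) : Fin (m + 1) → ℝ⟦X⟧ := Fin.cons 1 u

@[simp]
theorem withDrift_zero {m : ℕ} (u : Fin m → ℝ⟦X⟧) : withDrift u 0 = 1 := rfl

@[simp]
theorem withDrift_succ {m : ℕ} (u : Fin m → ℝ⟦X⟧) (i : Fin m) : withDrift u i.succ = u i := rfl

/-- The Chen-Fliess operator of a scalar series, as a linear map in the series. -/
noncomputable def fliessScalar {m : ℕ} (u : Fin m → ℝ⟦X⟧) : ScalarSeries m →ₗ[ℝ] ℝ⟦X⟧ where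
  toFun c := PowerSeries.mk fun n => ∑ η ∈ words m n, c η * coeff n (iterIntegral u η)
  map_add' c d := by
    ext n
    simp [add_mul, sum_add_distrib]
  map_smul' r c := by
    ext n
    simp [mul_assoc, mul_sum]

theorem coeff_fliessScalar {m : ℕ} (u : Fin m → ℝ⟦X⟧) (c : ScalarSeries m) {n N : ℕ}
    (h : n ≤ N) :
    coeff n (fliessScalar u c) = ∑ η ∈ words m N, c η * coeff n (iterIntegral u η) := by
  have : coeff n (fliessScalar u c) = ∑ η ∈ words m n, c η * coeff n (iterIntegral u η) := by
    simp [fliessScalar]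
  rw [this]
  refine sum_subset (fun η => by simp only [mem_words]; omega) fun η _ hη => ?_
  rw [coeff_iterIntegral_eq_zero u η n (by simpa using hη), mul_zero]

theorem fliess_apply {m ℓ : ℕ} (c : Series m ℓ) (u : Fin m → ℝ⟦X⟧) (j : Fin ℓ) :
    fliess c u j = fliessScalar u (component c j) := by
  ext n
  rw [coeff_fliessScalar u _ le_rfl, fliess, coeff_mk]
  exact finsum_eq_sum_words fun η hη => by rw [coeff_iterIntegral_eq_zero u η n hη, mul_zero]

@[simp]
theorem derivative_formalIntegral (f : ℝ⟦X⟧) : derivative ℝ (formalIntegral f) = f := by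
  ext n
  rw [coeff_derivative]
  simp only [formalIntegral, coeff_mk]
  exact div_mul_cancel₀ _ (by positivity)

@[simp]
theorem constantCoeff_formalIntegral (f : ℝ⟦X⟧) : constantCoeff (formalIntegral f) = 0 := by
  rw [← coeff_zero_eq_constantCoeff_apply]
  simp [formalIntegral]

theorem iterIntegral_cons {m : ℕ} (u : Fin m → ℝ⟦X⟧) (j : Fin (m + 1)) (η : Word m) :
    iterIntegral u (j :: η) = formalIntegral (withDrift u j * iterIntegral u η) := rfl

@[simp]
theorem constantCoeff_fliessScalar {m : ℕ} (u : Fin m → ℝ⟦X⟧) (c : ScalarSeries m) :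
    constantCoeff (fliessScalar u c) = c [] := by
  have h : words m 0 = {[]} := by
    ext η
    simp
  rw [← coeff_zero_eq_constantCoeff_apply, coeff_fliessScalar u c le_rfl, h]
  simp [iterIntegral]

theorem coeff_mul_fliessScalar {m : ℕ} (u : Fin m → ℝ⟦X⟧) (f : ℝ⟦X⟧) (c : ScalarSeries m)
    (n : ℕ) : coeff n (f * fliessScalar u c) =
      ∑ η ∈ words m n, c η * coeff n (f * iterIntegral u η) := by
  simp only [coeff_mul, mul_sum]
  rw [sum_comm]
  refine sum_congr rfl fun p hp => ?_
  have := mem_antidiagonal.mp hp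
  rw [coeff_fliessScalar u c (n := p.2) (N := n) (by omega), mul_sum]
  exact sum_congr rfl fun η _ => by ring

/-- The state equation of a Chen-Fliess operator: `F_c[u]' = ∑ⱼ uⱼ F_{xⱼ⁻¹ c}[u]`. Together with
the constant term `(c, ∅)` it determines `F_c[u]`. -/
theorem derivative_fliessScalar {m : ℕ} (u : Fin m → ℝ⟦X⟧) (c : ScalarSeries m) :
    derivative ℝ (fliessScalar u c) =
      ∑ j, withDrift u j * fliessScalar u (shift j c) := by
  ext n
  rw [coeff_derivative, coeff_fliessScalar u c le_rfl, sum_words_succ, map_sum]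
  simp only [coeff_mul_fliessScalar]
  have h1 : coeff (n + 1) (iterIntegral u []) = 0 := by simp [iterIntegral, coeff_one]
  rw [h1, mul_zero, zero_add, sum_mul]
  refine sum_congr rfl fun j _ => ?_
  rw [sum_mul]
  refine sum_congr rfl fun η _ => ?_
  rw [mul_assoc, ← coeff_derivative, iterIntegral_cons, derivative_formalIntegral]
  rfl

theorem eq_of_derivative_eq {f g : ℝ⟦X⟧} (h0 : constantCoeff f = constantCoeff g)
    (h : derivative ℝ f = derivative ℝ g) : f = g := derivative.ext h h0

@[simp]
theorem fliessScalar_oneScalar {m : ℕ} (u : Fin m → ℝ⟦X⟧) : fliessScalar u (oneScalar m) = 1 := by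
  refine eq_of_derivative_eq (by simp [oneScalar]) ?_
  have h : ∀ j, shift j (oneScalar m) = 0 := fun j => by
    funext η
    simp [shift, oneScalar]
  simp [derivative_fliessScalar, h]

theorem fliessScalar_letterMul {m : ℕ} (u : Fin m → ℝ⟦X⟧) (x : Fin (m + 1))
    (e : ScalarSeries m) :
    fliessScalar u (letterMul x e) = formalIntegral (withDrift u x * fliessScalar u e) := by
  refine eq_of_derivative_eq (by simp [letterMul]) ?_
  rw [derivative_fliessScalar, derivative_formalIntegral, Finset.sum_eq_single x]
  · congr 2
    funext η
    simp [shift, letterMul]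
  · intro j _ hj
    have : shift j (letterMul x e) = 0 := by
      funext η
      simp [shift, letterMul, hj]
    simp [this]
  · simp

/-- The shuffle product generates the product of outputs. Both sides solve the same linear
differential system, since left shifts are derivations of the shuffle product. -/
theorem fliessScalar_shuffleScalar {m : ℕ} (u : Fin m → ℝ⟦X⟧) (c d : ScalarSeries m) :
    fliessScalar u (shuffleScalar c d) = fliessScalar u c * fliessScalar u d := by
  let D : ScalarSeries m × ScalarSeries m → ℝ⟦X⟧ := fun p =>
    fliessScalar u (shuffleScalar p.1 p.2) - fliessScalar u p.1 * fliessScalar u p.2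
  refine sub_eq_zero.mp
    (eq_zero_of_derivative_mem_span (Set.range D) ?_ ?_ (D (c, d)) ⟨_, rfl⟩)
  · rintro _ ⟨⟨c, d⟩, rfl⟩
    simp [D, shuffleScalar_nil]
  · rintro _ ⟨⟨c, d⟩, rfl⟩
    have : derivative ℝ (D (c, d)) =
        ∑ j, withDrift u j * (D (shift j c, d) + D (c, shift j d)) := by
      simp only [D, map_sub, Derivation.leibniz, derivative_fliessScalar, shift_shuffleScalar,
        map_add, smul_eq_mul, mul_sum, ← sum_sub_distrib, ← sum_add_distrib]
      exact sum_congr rfl fun j _ => by ring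
    rw [this]
    exact sum_mem fun j _ => Ideal.mul_mem_left _ _
      (add_mem (Ideal.subset_span ⟨_, rfl⟩) (Ideal.subset_span ⟨_, rfl⟩))

/-! ### Operators of shuffle inverses and composition products -/

theorem fliess_shuffle {m ℓ : ℕ} (c d : Series m ℓ) (u : Fin m → ℝ⟦X⟧) :
    fliess (shuffle c d) u = fliess c u * fliess d u := by
  funext j
  simp only [Pi.mul_apply, fliess_apply]
  exact fliessScalar_shuffleScalar u _ _

theorem fliess_one {m ℓ : ℕ} (u : Fin m → ℝ⟦X⟧) : fliess (one m ℓ) u = 1 := by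
  funext j
  rw [fliess_apply]
  exact fliessScalar_oneScalar u

theorem constantCoeff_fliess {m ℓ : ℕ} (c : Series m ℓ) (u : Fin m → ℝ⟦X⟧) (j : Fin ℓ) :
    constantCoeff (fliess c u j) = c [] j := by
  rw [fliess_apply, constantCoeff_fliessScalar]
  rfl

theorem fliessScalar_shufflePow {m : ℕ} (u : Fin m → ℝ⟦X⟧) (c : ScalarSeries m) (k : ℕ) :
    fliessScalar u (shufflePow c k) = fliessScalar u c ^ k := by
  induction k with
  | zero => simp [shufflePow]
  | succ k ih => rw [shufflePow, fliessScalar_shuffleScalar, ih, pow_succ']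

/-- If `D = δ (1 - P)` where `P` has no constant term, then, modulo any power of the variable, a
shuffle inverse is `δ⁻¹` times a truncated geometric series in `P`. -/
theorem fliess_mul_fliess_shuffleInv {m ℓ : ℕ} (d : Series m ℓ) (hd : PurelyImproper d)
    (u : Fin m → ℝ⟦X⟧) : fliess d u * fliess (shuffleInv d) u = 1 := by
  funext i
  rw [Pi.mul_apply, fliess_apply, fliess_apply, Pi.one_apply]
  set p := normalizedPart (component d i) with hp
  have hp0 : p [] = 0 := by simp [hp, normalizedPart, oneScalar, component, hd i]
  have hD : fliessScalar u (component d i) = d [] i • (1 - fliessScalar u p) := by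
    rw [← fliessScalar_oneScalar u, ← map_sub, ← map_smul]
    congr 1
    funext η
    simp only [hp, normalizedPart, component, Pi.smul_apply, Pi.sub_apply, smul_eq_mul]
    have := hd i
    field_simp
    ring
  refine sub_eq_zero.mp (PowerSeries.ext fun n => ?_)
  have hI : (X : ℝ⟦X⟧) ^ (n + 1) ∣ fliessScalar u (component (shuffleInv d) i) -
      (d [] i)⁻¹ • ∑ k ∈ range (n + 1), fliessScalar u p ^ k := by
    rw [X_pow_dvd_iff]
    intro l hl
    simp only [← fliessScalar_shufflePow]
    rw [← map_sum, ← map_smul, ← map_sub, coeff_fliessScalar u _ le_rfl]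
    refine sum_eq_zero fun η hη => ?_
    have hη' : η.length ≤ l := mem_words.mp hη
    have hsum : ∑ᶠ k : ℕ, shufflePow p k η = ∑ k ∈ range (n + 1), shufflePow p k η := by
      refine finsum_eq_sum_of_support_subset _ fun k hk => ?_
      by_contra h
      simp only [coe_range, Set.mem_Iio, not_lt] at h
      exact hk (shufflePow_eq_zero p hp0 k η (by omega))
    have hinv : component (shuffleInv d) i η =
        (d [] i)⁻¹ * ∑ k ∈ range (n + 1), shufflePow p k η := congrArg (_ * ·) hsum
    simp [hinv]
  have hP : (X : ℝ⟦X⟧) ^ (n + 1) ∣ fliessScalar u p ^ (n + 1) := by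
    refine pow_dvd_pow_of_dvd ?_ _
    rw [X_dvd_iff, constantCoeff_fliessScalar, hp0]
  have hgeom : fliessScalar u (component d i) *
      ((d [] i)⁻¹ • ∑ k ∈ range (n + 1), fliessScalar u p ^ k) =
        1 - fliessScalar u p ^ (n + 1) := by
    rw [hD, smul_mul_smul_comm, mul_inv_cancel₀ (hd i), one_smul, mul_neg_geom_sum]
  have hdvd : (X : ℝ⟦X⟧) ^ (n + 1) ∣
      fliessScalar u (component d i) * fliessScalar u (component (shuffleInv d) i) - 1 := by
    have h := dvd_sub (Dvd.dvd.mul_left hI (fliessScalar u (component d i))) hP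
    rw [mul_sub, hgeom] at h
    convert h using 1
    ring
  simpa using X_pow_dvd_iff.mp hdvd n (by omega)

/-- A Chen-Fliess operator may be applied term by term to a sum `∑_η (c, η) P η` in which `P η`
has no words shorter than `η`. -/
theorem coeff_fliessScalar_finsum {m ℓ : ℕ} (u : Fin m → ℝ⟦X⟧) (c : ScalarSeries ℓ)
    (P : Word ℓ → ScalarSeries m) (hP : ∀ η ξ, ξ.length < η.length → P η ξ = 0) (n : ℕ) :
    coeff n (fliessScalar u fun ξ => ∑ᶠ η, c η * P η ξ) =
      ∑ η ∈ words ℓ n, c η * coeff n (fliessScalar u (P η)) := by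
  rw [coeff_fliessScalar u _ le_rfl]
  have h : ∀ ξ ∈ words m n, (∑ᶠ η, c η * P η ξ) * coeff n (iterIntegral u ξ) =
      ∑ η ∈ words ℓ n, c η * (P η ξ * coeff n (iterIntegral u ξ)) := by
    intro ξ hξ
    rw [mem_words] at hξ
    rw [finsum_eq_sum_words (n := n) fun η hη => by rw [hP η ξ (by omega), mul_zero], sum_mul]
    exact sum_congr rfl fun η _ => mul_assoc _ _ _
  rw [sum_congr rfl h, sum_comm]
  refine sum_congr rfl fun η _ => ?_
  rw [coeff_fliessScalar u _ le_rfl, mul_sum]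

theorem fliessScalar_psi {m ℓ : ℕ} (d : Series m ℓ) (u : Fin m → ℝ⟦X⟧) (η : Word ℓ) :
    fliessScalar u (psi d η (oneScalar m)) = iterIntegral (fliess d u) η := by
  induction η with
  | nil => exact fliessScalar_oneScalar u
  | cons i η ih =>
    rw [psi, fliessScalar_letterMul, fliessScalar_shuffleScalar, ih, iterIntegral_cons,
      withDrift_zero, one_mul]
    congr 2
    refine Fin.cases ?_ (fun i => ?_) i
    · simp
    · simp [fliess_apply]

theorem fliess_comp {m ℓ k : ℕ} (c : Series ℓ k) (d : Series m ℓ) (u : Fin m → ℝ⟦X⟧) :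
    fliess (comp c d) u = fliess c (fliess d u) := by
  funext j
  ext n
  rw [fliess_apply, fliess_apply, coeff_fliessScalar (fliess d u) _ le_rfl]
  refine (coeff_fliessScalar_finsum u (component c j) (fun η => psi d η (oneScalar m))
    (fun η ξ h => psi_eq_zero d η _ ξ h) n).trans ?_
  simp only [fliessScalar_psi]

theorem fliessScalar_phi {m : ℕ} (d : Series m m) (u : Fin m → ℝ⟦X⟧) (η : Word m) :
    fliessScalar u (phi d η (oneScalar m)) = iterIntegral (u * fliess d u) η := by
  induction η with
  | nil => exact fliessScalar_oneScalar u
  | cons i η ih =>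
    refine Fin.cases ?_ (fun i => ?_) i
    · rw [iterIntegral_cons, ← ih]
      exact fliessScalar_letterMul u 0 _
    · rw [iterIntegral_cons, ← ih, withDrift_succ, Pi.mul_apply, fliess_apply, mul_assoc,
        ← fliessScalar_shuffleScalar]
      exact fliessScalar_letterMul u i.succ _

theorem fliess_mixComp {m p : ℕ} (c : Series m p) (d : Series m m) (u : Fin m → ℝ⟦X⟧) :
    fliess (mixComp c d) u = fliess c (u * fliess d u) := by
  funext j
  ext n
  rw [fliess_apply, fliess_apply, coeff_fliessScalar (u * fliess d u) _ le_rfl]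
  refine (coeff_fliessScalar_finsum u (component c j) (fun η => phi d η (oneScalar m))
    (fun η ξ h => phi_eq_zero d η _ ξ h) n).trans ?_
  simp only [fliessScalar_phi]

theorem fliess_mulComp {m : ℕ} (f g : Series m m) (u : Fin m → ℝ⟦X⟧) :
    fliess (mulComp f g) u = fliess g u * fliess f (u * fliess g u) := by
  rw [mulComp, fliess_shuffle, fliess_mixComp]

/-! ### Injectivity of the passage from series to operators -/

/-- Causality: the output up to order `n` depends on the input up to order `n - 1` only. -/
theorem X_pow_succ_dvd_fliessScalar_sub {m : ℕ} {u w : Fin m → ℝ⟦X⟧} {n : ℕ}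
    (h : ∀ j, (X : ℝ⟦X⟧) ^ n ∣ w j - u j) (c : ScalarSeries m) :
    (X : ℝ⟦X⟧) ^ (n + 1) ∣ fliessScalar w c - fliessScalar u c := by
  have hU : ∀ j, (X : ℝ⟦X⟧) ^ n ∣ withDrift w j - withDrift u j :=
    Fin.cases (by simp) (fun j => by simpa using h j)
  have key : ∀ k ≤ n + 1, ∀ c : ScalarSeries m,
      (X : ℝ⟦X⟧) ^ k ∣ fliessScalar w c - fliessScalar u c := by
    intro k
    induction k with
    | zero => simp
    | succ k ih =>
      intro hk c
      refine X_pow_succ_dvd_of_derivative (by simp) ?_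
      rw [map_sub, derivative_fliessScalar, derivative_fliessScalar, ← sum_sub_distrib]
      refine dvd_sum fun j _ => ?_
      rw [show withDrift w j * fliessScalar w (shift j c) -
          withDrift u j * fliessScalar u (shift j c) =
          withDrift w j * (fliessScalar w (shift j c) - fliessScalar u (shift j c)) +
            (withDrift w j - withDrift u j) * fliessScalar u (shift j c) by ring]
      exact dvd_add (Dvd.dvd.mul_left (ih (by omega) _) _)
        (Dvd.dvd.mul_right ((pow_dvd_pow _ (by omega)).trans (hU j)) _)
  exact key _ le_rfl c

/-- The response of a Chen-Fliess operator to the perturbation of the `i`-th input by `tⁿ`. -/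
noncomputable def response {m : ℕ} (u : Fin m → ℝ⟦X⟧) (i : Fin m) (n : ℕ) (c : ScalarSeries m) :
    ℝ⟦X⟧ :=
  fliessScalar (u + Pi.single i (X ^ n)) c - fliessScalar u c

theorem X_pow_succ_dvd_response {m : ℕ} (u : Fin m → ℝ⟦X⟧) (i : Fin m) (n : ℕ)
    (c : ScalarSeries m) : (X : ℝ⟦X⟧) ^ (n + 1) ∣ response u i n c := by
  refine X_pow_succ_dvd_fliessScalar_sub (fun j => ?_) c
  rw [Pi.add_apply, add_sub_cancel_left]
  by_cases h : j = i
  · subst h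
    simp
  · simp [h]

theorem derivative_response {m : ℕ} (u : Fin m → ℝ⟦X⟧) (i : Fin m) (n : ℕ)
    (c : ScalarSeries m) : derivative ℝ (response u i n c) =
      ∑ j, withDrift u j * response u i n (shift j c) +
        X ^ n * fliessScalar (u + Pi.single i (X ^ n)) (shift i.succ c) := by
  have hU : ∀ j, withDrift (u + Pi.single i (X ^ n)) j =
      withDrift u j + if j = i.succ then X ^ n else 0 := by
    refine Fin.cases ?_ (fun j => ?_)
    · simp [(Fin.succ_ne_zero i).symm]
    · by_cases h : j = i
      · subst h
        simp
      · simp [h]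
  simp only [response, map_sub, derivative_fliessScalar, hU, add_mul, sum_add_distrib, mul_sub,
    sum_sub_distrib, ite_mul, zero_mul, sum_ite_eq', mem_univ, if_true]
  ring

theorem coeff_mul_of_X_pow_dvd {g : ℝ⟦X⟧} {n : ℕ} (h : (X : ℝ⟦X⟧) ^ n ∣ g) (f : ℝ⟦X⟧) (k : ℕ) :
    coeff (n + k) (f * g) = ∑ p ∈ antidiagonal k, coeff p.1 f * coeff (n + p.2) g := by
  obtain ⟨q, rfl⟩ := h
  rw [mul_left_comm, add_comm n k, coeff_X_pow_mul, coeff_mul]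
  refine sum_congr rfl fun p _ => ?_
  rw [add_comm n, coeff_X_pow_mul]

open Filter Topology

theorem tendsto_coeff_derivative_response_of {m : ℕ} (u : Fin m → ℝ⟦X⟧) (i : Fin m) (k : ℕ)
    (h : ∀ l ≤ k, ∀ c, Tendsto (fun n => coeff (n + l) (response u i n c)) atTop (𝓝 0))
    (c : ScalarSeries m) :
    Tendsto (fun n => coeff (n + k) (derivative ℝ (response u i n c))) atTop
      (𝓝 (coeff k (fliessScalar u (shift i.succ c)))) := by
  have h1 : Tendsto (fun n => ∑ j : Fin (m + 1), ∑ p ∈ antidiagonal k,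
      coeff p.1 (withDrift u j) * coeff (n + p.2) (response u i n (shift j c))) atTop
      (𝓝 0) := by
    rw [show (0 : ℝ) = ∑ j : Fin (m + 1), ∑ p ∈ antidiagonal k,
      coeff p.1 (withDrift u j) * 0 by simp]
    refine tendsto_finsetSum _ fun j _ => tendsto_finsetSum _ fun p hp => ?_
    have := mem_antidiagonal.mp hp
    exact (h p.2 (by omega) _).const_mul _
  have h2 := h1.add_const (coeff k (fliessScalar u (shift i.succ c)))
  rw [zero_add] at h2
  refine h2.congr' ?_
  filter_upwards [eventually_ge_atTop k] with n hn
  rw [derivative_response, map_add, map_sum]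
  congr 1
  · refine sum_congr rfl fun j _ => (coeff_mul_of_X_pow_dvd ?_ _ _).symm
    exact (pow_dvd_pow _ (by omega)).trans (X_pow_succ_dvd_response u i n _)
  · rw [add_comm n, coeff_X_pow_mul]
    have := X_pow_dvd_iff.mp (X_pow_succ_dvd_response u i n (shift i.succ c)) k (by omega)
    rw [response, map_sub] at this
    linarith

theorem tendsto_coeff_response {m : ℕ} (u : Fin m → ℝ⟦X⟧) (i : Fin m) (k : ℕ) :
    ∀ c, Tendsto (fun n => coeff (n + k) (response u i n c)) atTop (𝓝 0) := by
  induction k using Nat.strong_induction_on with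
  | _ k ih =>
    intro c
    rcases k with _ | k
    · refine tendsto_const_nhds.congr fun n => ?_
      exact (X_pow_dvd_iff.mp (X_pow_succ_dvd_response u i n c) n (by omega)).symm
    · have h := tendsto_coeff_derivative_response_of u i k (fun l hl => ih l (by omega)) c
      have h' : Tendsto (fun n : ℕ => (((n + k : ℕ) : ℝ) + 1)⁻¹) atTop (𝓝 0) := by
        have := tendsto_one_div_add_atTop_nhds_zero_nat (𝕜 := ℝ)
        simpa using (tendsto_add_atTop_iff_nat k).mpr this
      have h'' := h.mul h'
      rw [mul_zero] at h''
      refine h''.congr fun n => ?_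
      rw [← add_assoc, coeff_eq_of_derivative, div_eq_mul_inv]

/-- For large `n`, the input perturbation `tⁿ` of the `i`-th input changes the derivative of
`F_c[u]` by `tⁿ F_{xᵢ⁻¹ c}[u]`, up to terms whose coefficients at a fixed distance from `n` tend to
zero. Hence a vanishing operator has vanishing shifts. -/
theorem fliessScalar_shift_eq_zero {m : ℕ} {c : ScalarSeries m}
    (hc : ∀ u, fliessScalar u c = 0) (x : Fin (m + 1)) (u : Fin m → ℝ⟦X⟧) :
    fliessScalar u (shift x c) = 0 := by
  have hsucc : ∀ i : Fin m, fliessScalar u (shift i.succ c) = 0 := by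
    intro i
    ext k
    have h := tendsto_coeff_derivative_response_of u i k
      (fun l _ => tendsto_coeff_response u i l) c
    simp only [response, hc, sub_self, map_zero] at h
    simpa using tendsto_nhds_unique h tendsto_const_nhds
  refine Fin.cases ?_ hsucc x
  have h := derivative_fliessScalar u c
  rw [hc, map_zero, Fin.sum_univ_succ] at h
  simpa [hsucc] using h.symm

theorem eq_zero_of_fliessScalar_eq_zero {m : ℕ} {c : ScalarSeries m}
    (hc : ∀ u, fliessScalar u c = 0) : c = 0 := by
  funext η
  induction η generalizing c with
  | nil => rw [← constantCoeff_fliessScalar 0 c, hc, map_zero, Pi.zero_apply]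
  | cons x η ih => exact ih (c := shift x c) (fliessScalar_shift_eq_zero hc x)

/-- A generating series is determined by its Chen-Fliess operator on formal inputs. -/
theorem fliess_injective {m ℓ : ℕ} : Function.Injective (fliess : Series m ℓ → _) := by
  intro c d h
  have hj : ∀ j, component c j - component d j = 0 := fun j =>
    eq_zero_of_fliessScalar_eq_zero fun u => by
      rw [map_sub, ← fliess_apply, ← fliess_apply, h, sub_self]
  funext η j
  exact sub_eq_zero.mp (congrFun (hj j) η)

/-! ### The group of multiplicative feedback series -/

theorem shuffleScalar_congr {m : ℕ} {c c' d d' : ScalarSeries m} {η : Word m}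
    (hc : ∀ ζ : Word m, ζ.length ≤ η.length → c ζ = c' ζ)
    (hd : ∀ ζ : Word m, ζ.length ≤ η.length → d ζ = d' ζ) :
    shuffleScalar c d η = shuffleScalar c' d' η := by
  rw [shuffleScalar_eq_sum c d η le_rfl le_rfl, shuffleScalar_eq_sum c' d' η le_rfl le_rfl]
  refine sum_congr rfl fun p hp => sum_congr rfl fun q hq => ?_
  rw [hc p (mem_words.mp hp), hd q (mem_words.mp hq)]

theorem phi_congr {m n : ℕ} {g g' : Series m m}
    (h : ∀ ξ : Word m, ξ.length < n → g ξ = g' ξ) (η ξ : Word m) (hξ : ξ.length ≤ n) :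
    phi g η (oneScalar m) ξ = phi g' η (oneScalar m) ξ := by
  induction η generalizing ξ with
  | nil => rfl
  | cons x η ih =>
    rcases ξ with _ | ⟨y, ξ⟩
    · refine Fin.cases ?_ (fun i => ?_) x <;> rfl
    · have hlt : ξ.length < n := by simpa using hξ
      refine Fin.cases ?_ (fun i => ?_) x
      · change (if y = 0 then _ else _) = (if y = 0 then _ else _)
        rw [ih ξ hlt.le]
      · change (if y = i.succ then _ else _) = (if y = i.succ then _ else _)
        congr 1
        refine shuffleScalar_congr (fun ζ hζ => ?_) (fun ζ hζ => ih ζ (by omega))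
        exact congrFun (h ζ (by omega)) i

/-- The coefficients of `h ∘~ δ_g` at words of length `n` involve only the coefficients of `g` at
shorter words. -/
theorem mixComp_congr {m p n : ℕ} (h : Series m p) {g g' : Series m m}
    (hg : ∀ ξ : Word m, ξ.length < n → g ξ = g' ξ) (ξ : Word m) (hξ : ξ.length ≤ n) :
    mixComp h g ξ = mixComp h g' ξ := by
  funext j
  exact finsum_congr fun η => by rw [phi_congr hg η ξ hξ]

/-- The map `g ↦ h ∘~ δ_g` has a fixed point, being a contraction for the ultrametric which measures
the length of the shortest word at which two series differ. -/
theorem exists_eq_mixComp_self {m : ℕ} (h : Series m m) : ∃ g, g = mixComp h g := by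
  let G : ℕ → Series m m := fun k => (mixComp h)^[k] 0
  have hG : ∀ k, G (k + 1) = mixComp h (G k) := fun k => Function.iterate_succ_apply' _ _ _
  have hstep : ∀ k, ∀ ξ : Word m, ξ.length < k → G (k + 1) ξ = G k ξ := by
    intro k
    induction k with
    | zero => intro ξ hξ; omega
    | succ k ih =>
      intro ξ hξ
      rw [hG (k + 1), hG k]
      refine mixComp_congr h (fun ζ hζ => ?_) ξ (Nat.lt_succ_iff.mp hξ)
      rw [← hG k]
      exact ih ζ hζ
  have hlim : ∀ (ξ : Word m) (k : ℕ), ξ.length + 1 ≤ k → G k ξ = G (ξ.length + 1) ξ := by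
    intro ξ k hk
    induction k, hk using Nat.le_induction with
    | base => rfl
    | succ k hk ih => rw [hstep k ξ (by omega), ih]
  refine ⟨fun ξ => G (ξ.length + 1) ξ, funext fun ξ => ?_⟩
  rw [hG]
  exact mixComp_congr h (fun ζ hζ => hlim ζ _ (by omega)) ξ le_rfl

theorem one_mulComp {m : ℕ} (f : Series m m) : mulComp (one m m) f = f :=
  fliess_injective <| funext fun u => by rw [fliess_mulComp, fliess_one, mul_one]

theorem mulComp_one {m : ℕ} (f : Series m m) : mulComp f (one m m) = f :=
  fliess_injective <| funext fun u => by rw [fliess_mulComp, fliess_one, one_mul, mul_one]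

theorem mulComp_assoc {m : ℕ} (f g h : Series m m) :
    mulComp (mulComp f g) h = mulComp f (mulComp g h) :=
  fliess_injective <| funext fun u => by simp only [fliess_mulComp, mul_assoc]

theorem PurelyImproper.of_fliess_mul_eq_one {m ℓ : ℕ} {c : Series m ℓ} {u : Fin m → ℝ⟦X⟧}
    {w : Fin ℓ → ℝ⟦X⟧} (h : fliess c u * w = 1) : PurelyImproper c := by
  intro i h0
  have := congrArg constantCoeff (congrFun h i)
  rw [Pi.mul_apply, map_mul, constantCoeff_fliess, h0] at this
  simp at this

/-- A right inverse of `δ_f` is a solution of `g = f^{⧢ -1} ∘~ δ_g`. -/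
theorem exists_mulComp_eq_one {m : ℕ} {f : Series m m} (hf : PurelyImproper f) :
    ∃ g, PurelyImproper g ∧ mulComp f g = one m m := by
  obtain ⟨g, hg⟩ := exists_eq_mixComp_self (shuffleInv f)
  have key : ∀ u, fliess g u * fliess f (u * fliess g u) = 1 := by
    intro u
    have h := fliess_mul_fliess_shuffleInv f hf (u * fliess g u)
    rwa [← fliess_mixComp (shuffleInv f), ← hg, mul_comm] at h
  refine ⟨g, .of_fliess_mul_eq_one (key 0), fliess_injective <| funext fun u => ?_⟩
  rw [fliess_mulComp, fliess_one, key]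

theorem existsUnique_isMulCompInv {m : ℕ} {f : Series m m} (hf : PurelyImproper f) :
    ∃! g, IsMulCompInv f g := by
  obtain ⟨g, hg, hfg⟩ := exists_mulComp_eq_one hf
  obtain ⟨k, -, hgk⟩ := exists_mulComp_eq_one hg
  have hk : k = f := by
    rw [← one_mulComp k, ← hfg, mulComp_assoc, hgk, mulComp_one]
  subst hk
  refine ⟨g, ⟨hg, hfg, hgk⟩, fun g' hg' => ?_⟩
  rw [← mulComp_one g', ← hfg, ← mulComp_assoc, hg'.2.2, one_mulComp]

theorem isMulCompInv_mulCompInv {m : ℕ} {f : Series m m} (hf : PurelyImproper f) :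
    IsMulCompInv f (mulCompInv f) := by
  have h := (existsUnique_isMulCompInv hf).exists
  rw [mulCompInv, dif_pos h]
  exact h.choose_spec

/-! ### The closed loop -/

theorem fliess_mul_fliess_comp_shuffleInv {m q : ℕ} (c : Series m q) {d : Series q m}
    (hd : PurelyImproper d) (u : Fin m → ℝ⟦X⟧) :
    fliess d (fliess c u) * fliess (comp (shuffleInv d) c) u = 1 := by
  rw [fliess_comp]
  exact fliess_mul_fliess_shuffleInv d hd _

theorem purelyImproper_comp_shuffleInv {m q : ℕ} (c : Series m q) {d : Series q m}
    (hd : PurelyImproper d) : PurelyImproper (comp (shuffleInv d) c) := by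
  refine .of_fliess_mul_eq_one (u := 0) (w := fliess d (fliess c 0)) ?_
  rw [mul_comm, fliess_mul_fliess_comp_shuffleInv c hd]

/-- Put `f = d^{⧢ -1} ∘ c` and `g = f^{∘ -1}`. The loop equation `u = v · F_d[F_c[u]]` is equivalent
to `u · F_f[u] = v`, hence to `u = v · F_g[v]`. -/
theorem exists_isClosedLoop_iff {m q : ℕ} (c : Series m q) {d : Series q m}
    (hd : PurelyImproper d) (v : Fin m → ℝ⟦X⟧) (y : Fin q → ℝ⟦X⟧) :
    (∃ u, IsClosedLoop c d v u y) ↔ y = fliess (feedbackProduct c d) v := by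
  set f := comp (shuffleInv d) c with hf
  obtain ⟨-, hfg, hgf⟩ := isMulCompInv_mulCompInv (purelyImproper_comp_shuffleInv c hd)
  rw [← hf] at hfg hgf
  set g := mulCompInv f with hg
  have hdf := fliess_mul_fliess_comp_shuffleInv c hd
  have hfg' : fliess g v * fliess f (v * fliess g v) = 1 := by
    rw [← fliess_mulComp, hfg, fliess_one]
  have hy : fliess (feedbackProduct c d) v = fliess c (v * fliess g v) := fliess_mixComp c g v
  rw [hy]
  constructor
  · rintro ⟨u, rfl, hu⟩
    have hgf' : fliess f u * fliess g (u * fliess f u) = 1 := by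
      rw [← fliess_mulComp, hgf, fliess_one]
    have hv : u * fliess f u = v := by
      calc u * fliess f u = v * (fliess d (fliess c u) * fliess f u) := by
            rw [← mul_assoc, ← hu]
        _ = v := by rw [hdf, mul_one]
    rw [← hv, mul_assoc, hgf', mul_one]
  · rintro rfl
    refine ⟨v * fliess g v, rfl, ?_⟩
    congr 1
    refine (mul_one _).symm.trans ?_
    rw [← hdf (v * fliess g v), mul_left_comm, hfg', mul_one]

theorem isClosedLoopSeries_iff {m q : ℕ} (c : Series m q) {d : Series q m}
    (hd : PurelyImproper d) (e : Series m q) :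
    IsClosedLoopSeries c d e ↔ e = feedbackProduct c d := by
  constructor
  · intro he
    refine fliess_injective <| funext fun v => ?_
    exact (exists_isClosedLoop_iff c hd v _).mp ((he v _).mpr rfl)
  · rintro rfl
    exact exists_isClosedLoop_iff c hd

/-- The equation `e = c ∘~ δ_{d ∘ e}` says that `F_e[v]` solves the loop with the plant input
`v · F_d[F_e[v]]`. -/
theorem eq_mixComp_comp_iff {m q : ℕ} (c : Series m q) {d : Series q m}
    (hd : PurelyImproper d) (e : Series m q) :
    e = mixComp c (comp d e) ↔ e = feedbackProduct c d := by
  have h : e = mixComp c (comp d e) ↔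
      ∀ v, fliess e v = fliess c (v * fliess d (fliess e v)) := by
    rw [← fliess_injective.eq_iff, funext_iff]
    simp only [fliess_mixComp, fliess_comp]
  rw [h, ← fliess_injective.eq_iff, funext_iff]
  refine forall_congr' fun v => ?_
  rw [← exists_isClosedLoop_iff c hd]
  constructor
  · intro he
    exact ⟨_, he, rfl⟩
  · rintro ⟨u, hy, hu⟩
    rwa [← hu]

end ChenFliess

theorem mainTheorem3 (m q : ℕ) (c : ChenFliess.Series m q) (d : ChenFliess.Series q m)
    (hd : ChenFliess.PurelyImproper d) :
    -- the inverse that occurs in the formula exists and is unique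
    ChenFliess.PurelyImproper (ChenFliess.comp (ChenFliess.shuffleInv d) c) ∧
    (∃! g : ChenFliess.Series m m,
      ChenFliess.IsMulCompInv (ChenFliess.comp (ChenFliess.shuffleInv d) c) g) ∧
    -- the feedback product is the one and only generating series of the closed loop
    (∀ e : ChenFliess.Series m q,
      ChenFliess.IsClosedLoopSeries c d e ↔ e = ChenFliess.feedbackProduct c d) ∧
    -- it is also the unique solution of the closed-loop equation between series
    (∀ e : ChenFliess.Series m q,
      e = ChenFliess.mixComp c (ChenFliess.comp d e) ↔ e = ChenFliess.feedbackProduct c d) :=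
  ⟨ChenFliess.purelyImproper_comp_shuffleInv c hd,
    ChenFliess.existsUnique_isMulCompInv (ChenFliess.purelyImproper_comp_shuffleInv c hd),
    ChenFliess.isClosedLoopSeries_iff c hd, ChenFliess.eq_mixComp_comp_iff c hd⟩
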